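/- Let $R$ be a real symmetric $n\times n$ matrix with zero diagonal, let $J=I-R$, let $|R|=(|r_{ij}|)$ and let $\rho$ denote the spectral radius. Let $\gamma>\gamma^*:=\rho(|R|)-1$ and $J'=J+\gamma I=(1+\gamma)I-R$. Then: (a) $1+\gamma>0$, the normalization of $J'$ to unit diagonal is $I-R'$ with $R'=(1+\gamma)^{-1}R$, and $\rho(|R'|)=\rho(|R|/(1+\gamma))<1$; that is, $J'$ is walk-summable. In particular $J'$ is positive definite. (b) Gaussian belief propagation (GaBP) based on $J'$ converges for every potential vector $h\in\mathbb{R}^n$. Here $N(i)=\{k\ne i: J'_{ik}\neq 0\}$; the messages $\alpha_{ij},\beta_{ij}$ ($j\in N(i)$) start at $0$ and are updated by $$\alpha_{ij}\leftarrow-\frac{(J'_{ij})^2}{\alpha_{i\backslash j}},\qquad \beta_{ij}\leftarrow-\frac{J'_{ij}\,\beta_{i\backslash j}}{\alpha_{i\backslash j}},\qquad \alpha_{i\backslash j}=J'_{ii}+\sum_{k\in N(i)\setminus j}\alpha_{ki},\quad \beta_{i\backslash j}=h_i+\sum_{k\in N(i)\setminus j}\beta_{ki},$$ where in each round an arbitrary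 set of messages is updated simultaneously, subject only to every message being updated infinitely often (this includes the parallel schedule and sequential in-place sweeps in any order). The inferred quantities are $\hat K_i=\big(J'_{ii}+\sum_{k\in N(i)}\alpha_{ki}\big)^{-1}$ and $\hat\mu_i=\hat K_i\big(h_i+\sum_{k\in N(i)}\beta_{ki}\big)$. Convergence means: all inverted quantities ($\alpha_{i\backslash j}$ and $\hat K_i^{-1}$) are positive in every round and in the limit, all messages converge, and $\hat K_i,\hat\mu_i$ converge to the values inferred from the limiting messages. Moreover $\hat\mu$ converges to the MAP estimate $J'^{-1}h$. -/

import Mathlib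

open Filter Topology

noncomputable section

namespace GaBP

variable {V : Type*} [Fintype V] [DecidableEq V]

/-- The entrywise absolute value `|A| = (|a_{ij}|)` of a real matrix. -/
def absMatrix (A : Matrix V V ℝ) : Matrix V V ℝ := A.map (fun x => |x|)

/-- The spectral radius `ρ(A)` of a real square matrix: the largest modulus of its complex
eigenvalues, as a real number. It is `0` for the empty matrix. -/
def specRadius (A : Matrix V V ℝ) : ℝ :=
  (spectralRadius ℂ (A.map (algebraMap ℝ ℂ))).toReal

/-- The supremum in `specRadius` is over a finite set, so `toReal` loses nothing. -/
theorem spectralRadius_ne_top (A : Matrix V V ℝ) :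
    spectralRadius ℂ (A.map (algebraMap ℝ ℂ)) ≠ ⊤ := by
  have hfin : (spectrum ℂ (A.map (algebraMap ℝ ℂ))).Finite := Matrix.finite_spectrum _
  unfold spectralRadius
  rw [← lt_top_iff_ne_top]
  have h := (hfin.image (fun k : ℂ => ‖k‖₊)).bddAbove
  obtain ⟨M, hM⟩ := h
  refine lt_of_le_of_lt (iSup₂_le (a := (M : ENNReal)) fun k hk => ?_) ENNReal.coe_lt_top
  exact ENNReal.coe_le_coe.2 (hM ⟨k, hk, rfl⟩)

/-- Rescaling of the variables to unit diagonal: `D^{-1/2} J D^{-1/2}` with `D = diag(J)`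
(meaningful when the diagonal of `J` is positive). -/
def normalize (J : Matrix V V ℝ) : Matrix V V ℝ :=
  Matrix.of fun i j => J i j / (Real.sqrt (J i i) * Real.sqrt (J j j))

/-- A model with information matrix `J` is walk-summable if it has positive diagonal and, after
normalization to unit diagonal `I - R'`, the spectral radius of `|R'|` is less than one. -/
def WalkSummable (J : Matrix V V ℝ) : Prop :=
  (∀ i, 0 < J i i) ∧ specRadius (absMatrix (1 - normalize J)) < 1

/-- The neighbours of `i` in the graph of the symmetric matrix `J`. -/
def neighbors (J : Matrix V V ℝ) (i : V) : Finset V :=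
  open Classical in Finset.univ.filter fun k => k ≠ i ∧ J i k ≠ 0

/-- The messages of Gaussian belief propagation: `α i j` and `β i j` are sent from `i` to `j`. -/
structure Messages (V : Type*) where
  α : V → V → ℝ
  β : V → V → ℝ

/-- `α_{i∖j} = J_{ii} + ∑_{k ∈ N(i)∖j} α_{ki}`. -/
def cavityPrecision (J : Matrix V V ℝ) (m : Messages V) (i j : V) : ℝ :=
  J i i + ∑ k ∈ (neighbors J i).erase j, m.α k i

/-- `β_{i∖j} = h_i + ∑_{k ∈ N(i)∖j} β_{ki}`. -/
def cavityPotential (J : Matrix V V ℝ) (h : V → ℝ) (m : Messages V) (i j : V) : ℝ :=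
  h i + ∑ k ∈ (neighbors J i).erase j, m.β k i

open Classical in
/-- One round of message updates: the messages on those directed edges that lie in `S` are
recomputed from the current messages, all others are kept. With `S` everything this is a parallel
(flooding) iteration, with `S` a single edge it is one serial (in-place) update. -/
def step (J : Matrix V V ℝ) (h : V → ℝ) (S : Set (V × V)) (m : Messages V) : Messages V where
  α i j := if j ∈ neighbors J i ∧ (i, j) ∈ S then
    -(J i j) ^ 2 * (cavityPrecision J m i j)⁻¹ else m.α i j
  β i j := if j ∈ neighbors J i ∧ (i, j) ∈ S then
    -(J i j) * (cavityPrecision J m i j)⁻¹ * cavityPotential J h m i j else m.β i j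

/-- The messages after `t` rounds, initialized at zero, where round `t` updates the edges in
`S t`. -/
def messages (J : Matrix V V ℝ) (h : V → ℝ) (S : ℕ → Set (V × V)) : ℕ → Messages V
  | 0 => ⟨fun _ _ => 0, fun _ _ => 0⟩
  | t + 1 => step J h (S t) (messages J h S t)

/-- A schedule is fair if every directed edge of the graph is updated infinitely often. -/
def FairSchedule (J : Matrix V V ℝ) (S : ℕ → Set (V × V)) : Prop :=
  ∀ i, ∀ j ∈ neighbors J i, ∃ᶠ t in atTop, (i, j) ∈ S t

/-- The estimated marginal precision `J_{ii} + ∑_{k ∈ N(i)} α_{ki}`. -/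
def marginalPrecision (J : Matrix V V ℝ) (m : Messages V) (i : V) : ℝ :=
  J i i + ∑ k ∈ neighbors J i, m.α k i

/-- The variance estimate `K̂_i`. -/
def varianceEstimate (J : Matrix V V ℝ) (m : Messages V) (i : V) : ℝ :=
  (marginalPrecision J m i)⁻¹

/-- The mean estimate `μ̂_i = K̂_i (h_i + ∑_{k ∈ N(i)} β_{ki})`, the output of the algorithm. -/
def meanEstimate (J : Matrix V V ℝ) (h : V → ℝ) (m : Messages V) (i : V) : ℝ :=
  varianceEstimate J m i * (h i + ∑ k ∈ neighbors J i, m.β k i)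

/-- All the precisions that are inverted, in the updates and in the final inference step, are
positive. -/
def WellPosed (J : Matrix V V ℝ) (m : Messages V) : Prop :=
  (∀ i, ∀ j ∈ neighbors J i, 0 < cavityPrecision J m i j) ∧ ∀ i, 0 < marginalPrecision J m i

/-- Gaussian belief propagation for `(h, J)` with schedule `S` converges: every round is well
posed, all messages converge to well-posed limiting messages, and the inferred variances and
means converge to the ones inferred from the limiting messages. -/
def Converges (J : Matrix V V ℝ) (h : V → ℝ) (S : ℕ → Set (V × V)) : Prop :=
  (∀ t, WellPosed J (messages J h S t)) ∧
  ∃ m : Messages V, WellPosed J m ∧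
    (∀ i j, Tendsto (fun t => (messages J h S t).α i j) atTop (𝓝 (m.α i j))) ∧
    (∀ i j, Tendsto (fun t => (messages J h S t).β i j) atTop (𝓝 (m.β i j))) ∧
    (∀ i, Tendsto (fun t => varianceEstimate J (messages J h S t) i) atTop
      (𝓝 (varianceEstimate J m i))) ∧
    (∀ i, Tendsto (fun t => meanEstimate J h (messages J h S t) i) atTop
      (𝓝 (meanEstimate J h m i)))

end GaBP

end

/-!
Write `c = 1 + γ > ρ(|R|)`. Since `|R|` is symmetric, `c - |R|` is positive definite, and hence so
is `J' = c - R`. As a positive definite matrix with nonpositive off-diagonal entries, `c - |R|` is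
an M-matrix: there is a vector `v > 0` with `(c - |R|) v = 1` (`exists_pos_mulVec_eq_one`). In other
words `J'` is strictly diagonally dominant with respect to the weights `v`, and the convergence of
belief propagation is deduced from this alone (`Dominant.converges`).

*Precision messages.* From zero, they satisfy `α_{ij} ≥ -|J_{ij}| v_i / v_j` under any sequence
of updates. This makes all precisions positive. On this region the update map is monotone, and the
initial messages are a supersolution, so the messages decrease under any schedule
(`IsSupersolution.step`). They converge, and by fairness the limit is a fixed point
(`exists_tendsto_α`).

*Potential messages.* Let `J' x = h`. The quantities `-J_{ij} x_i + α_{ij} x_j`, formed with the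
current precision messages, satisfy the potential update exactly (`update_exact`). The deviation of
`β` from them therefore obeys the homogeneous linear update, whose coefficients are dominated by
those at the limiting precisions. The same identity for the model with off-diagonal entries
`-|J_{ij}|` and solution `v` shows that the weights `|J_{ij}| v_i + α_{ij} v_j` at the limit are
strictly decreased by this update with absolute values (`weight_contraction`). So it is a weighted
max-norm contraction, its totally asynchronous iteration tends to zero
(`tendsto_zero_of_async_contraction`), and `β` converges to `-J_{ij} x_i + α_{ij} x_j`. With these
messages the estimated means are exactly `x` (`meanEstimate_exact`).
-/

namespace GaBP

/-! ### Asynchronous weighted max-norm contractions -/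

/-- Convergence of totally asynchronous iterations: if an update of the coordinate `a` maps the
box `|e| ≤ M w` into the strictly smaller bound `M u a`, and every coordinate is updated
infinitely often and otherwise kept, then every coordinate tends to zero. -/
theorem tendsto_zero_of_async_contraction {ι : Type*} [Finite ι] {e : ℕ → ι → ℝ} {u w : ι → ℝ}
    {U : ℕ → Set ι} (hw : ∀ a, 0 < w a) (huw : ∀ a, u a < w a)
    (hfair : ∀ a, ∃ᶠ t in atTop, a ∈ U t)
    (hkeep : ∀ t, ∀ a ∉ U t, e (t + 1) a = e t a)
    (hupd : ∀ t M, 0 ≤ M → (∀ a, |e t a| ≤ M * w a) → ∀ a ∈ U t, |e (t + 1) a| ≤ M * u a)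
    (a : ι) : Tendsto (fun t => e t a) atTop (𝓝 0) := by
  obtain ⟨θ, hθ0, hθ1, hθ⟩ : ∃ θ : ℝ, 0 < θ ∧ θ < 1 ∧ ∀ b, u b ≤ θ * w b := by
    have h1 : ∀ᶠ θ : ℝ in 𝓝[<] 1, ∀ b, u b / w b < θ := eventually_all.2 fun b =>
      mem_nhdsWithin_of_mem_nhds (Ioi_mem_nhds ((div_lt_one (hw b)).2 (huw b)))
    have h2 : ∀ᶠ θ : ℝ in 𝓝[<] 1, 0 < θ := mem_nhdsWithin_of_mem_nhds (Ioi_mem_nhds one_pos)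
    obtain ⟨θ, h, h0, h1⟩ := (h1.and (h2.and self_mem_nhdsWithin)).exists
    exact ⟨θ, h0, h1, fun b => ((div_lt_iff₀ (hw b)).1 (h b)).le⟩
  obtain ⟨M, hM0, hM⟩ : ∃ M : ℝ, 0 ≤ M ∧ ∀ b, |e 0 b| ≤ M * w b := by
    have h : ∀ᶠ M : ℝ in atTop, ∀ b, |e 0 b| ≤ M * w b := eventually_all.2 fun b =>
      (eventually_ge_atTop (|e 0 b| / w b)).mono fun M hM => (div_le_iff₀ (hw b)).1 hM
    obtain ⟨M, h, h0⟩ := (h.and (eventually_ge_atTop 0)).exists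
    exact ⟨M, h0, h⟩
  have box : ∀ n : ℕ, ∀ᶠ t in atTop, ∀ b, |e t b| ≤ θ ^ n * M * w b := by
    intro n
    induction n with
    | zero =>
      refine Eventually.of_forall fun t => ?_
      induction t with
      | zero => simpa using hM
      | succ t ih =>
        intro b
        by_cases hb : b ∈ U t
        · refine (hupd t _ (by simpa using hM0) ih b hb).trans ?_
          exact mul_le_mul_of_nonneg_left (huw b).le (by simpa using hM0)
        · rw [hkeep t b hb]
          exact ih b
    | succ n ih =>
      obtain ⟨T, hT⟩ := eventually_atTop.1 ih
      refine eventually_all.2 fun b => ?_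
      have small : ∀ t ≥ T, b ∈ U t → |e (t + 1) b| ≤ θ ^ (n + 1) * M * w b := by
        intro t ht hb
        calc |e (t + 1) b| ≤ θ ^ n * M * u b := hupd t _ (by positivity) (hT t ht) b hb
          _ ≤ θ ^ n * M * (θ * w b) := by gcongr; exact hθ b
          _ = θ ^ (n + 1) * M * w b := by ring
      obtain ⟨t₀, ht₀, hb₀⟩ := frequently_atTop.1 (hfair b) T
      refine eventually_atTop.2 ⟨t₀ + 1, fun t ht => ?_⟩
      induction t, ht using Nat.le_induction with
      | base => exact small t₀ ht₀ hb₀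
      | succ t ht ih' =>
        by_cases hb : b ∈ U t
        · exact small t (by omega) hb
        · rw [hkeep t b hb]
          exact ih'
  have hlim : Tendsto (fun n : ℕ => θ ^ n * M * w a) atTop (𝓝 0) := by
    simpa using ((tendsto_pow_atTop_nhds_zero_of_lt_one hθ0.le hθ1).mul_const M).mul_const (w a)
  refine Metric.tendsto_nhds.2 fun ε hε => ?_
  obtain ⟨n, hn⟩ := (hlim.eventually (gt_mem_nhds hε)).exists
  filter_upwards [box n] with t ht
  rw [Real.dist_0_eq_abs]
  exact (ht a).trans_lt hn

variable {V : Type*} [Fintype V] [DecidableEq V]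

/-! ### Elementary facts about neighbourhoods and update rounds -/

theorem mem_neighbors {J : Matrix V V ℝ} {i k : V} : k ∈ neighbors J i ↔ k ≠ i ∧ J i k ≠ 0 := by
  simp [neighbors]

theorem mem_neighbors_comm {J : Matrix V V ℝ} (hJ : J.IsSymm) {i k : V} :
    k ∈ neighbors J i ↔ i ∈ neighbors J k := by
  rw [mem_neighbors, mem_neighbors, hJ.apply k i, ne_comm]

theorem sum_neighbors {J : Matrix V V ℝ} {f : V → ℝ} {i : V}
    (hf : ∀ k, J i k = 0 → f k = 0) : ∑ k ∈ neighbors J i, f k + f i = ∑ k, f k := by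
  rw [← Finset.sum_erase_add _ _ (Finset.mem_univ i)]
  congr 1
  refine Finset.sum_subset (fun k hk => by simpa using (mem_neighbors.1 hk).1) fun k hk hk' => ?_
  refine hf k (by_contra fun h => hk' (mem_neighbors.2 ⟨Finset.ne_of_mem_erase hk, h⟩))

theorem mulVec_eq_sum_neighbors (J : Matrix V V ℝ) (x : V → ℝ) (i : V) :
    J.mulVec x i = J i i * x i + ∑ k ∈ neighbors J i, J i k * x k := by
  rw [add_comm, sum_neighbors (f := fun k => J i k * x k) (fun k hk => by simp [hk])]
  rfl

section Step

variable {J : Matrix V V ℝ} {h : V → ℝ} {S : Set (V × V)} {m : Messages V} {i j : V}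

theorem step_α_of_mem (hj : j ∈ neighbors J i) (hS : (i, j) ∈ S) :
    (step J h S m).α i j = -(J i j) ^ 2 * (cavityPrecision J m i j)⁻¹ :=
  if_pos ⟨hj, hS⟩

theorem step_β_of_mem (hj : j ∈ neighbors J i) (hS : (i, j) ∈ S) :
    (step J h S m).β i j =
      -(J i j) * (cavityPrecision J m i j)⁻¹ * cavityPotential J h m i j :=
  if_pos ⟨hj, hS⟩

theorem step_α_of_notMem (hS : ¬(j ∈ neighbors J i ∧ (i, j) ∈ S)) :
    (step J h S m).α i j = m.α i j :=
  if_neg hS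

theorem step_β_of_notMem (hS : ¬(j ∈ neighbors J i ∧ (i, j) ∈ S)) :
    (step J h S m).β i j = m.β i j :=
  if_neg hS

end Step

theorem messages_of_notMem_neighbors {J : Matrix V V ℝ} {h : V → ℝ} {S : ℕ → Set (V × V)}
    {i j : V} (hj : j ∉ neighbors J i) (t : ℕ) :
    (messages J h S t).α i j = 0 ∧ (messages J h S t).β i j = 0 := by
  induction t with
  | zero => exact ⟨rfl, rfl⟩
  | succ t ih =>
    exact ⟨(step_α_of_notMem fun H => hj H.1).trans ih.1,
      (step_β_of_notMem fun H => hj H.1).trans ih.2⟩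

section BeliefPropagation

/-! ### The precision messages of a generalized diagonally dominant model -/

/-- `J` is strictly diagonally dominant after scaling its columns by the positive weights `v`. -/
structure Dominant (J : Matrix V V ℝ) (v : V → ℝ) : Prop where
  pos : ∀ i, 0 < v i
  sum_lt : ∀ i, ∑ k ∈ neighbors J i, |J i k| * v k < J i i * v i

/-- The invariant `α_{ij} ≥ -|J_{ij}| v_i / v_j` that keeps all precisions positive. -/
def PrecisionBound (J : Matrix V V ℝ) (v : V → ℝ) (m : Messages V) : Prop :=
  ∀ i, ∀ j ∈ neighbors J i, -(|J i j| * v i) ≤ m.α i j * v j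

/-- Recomputing any precision message of `m` would not increase it. -/
def IsSupersolution (J : Matrix V V ℝ) (m : Messages V) : Prop :=
  ∀ i, ∀ j ∈ neighbors J i, -(J i j) ^ 2 * (cavityPrecision J m i j)⁻¹ ≤ m.α i j

variable {J : Matrix V V ℝ} {v : V → ℝ} {h : V → ℝ} {m : Messages V} {i j : V}

theorem PrecisionBound.neg_le_sum (hJ : J.IsSymm) (hm : PrecisionBound J v m)
    {s : Finset V} (hs : s ⊆ neighbors J i) :
    -∑ k ∈ s, |J i k| * v k ≤ (∑ k ∈ s, m.α k i) * v i := by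
  rw [Finset.sum_mul, ← Finset.sum_neg_distrib]
  refine Finset.sum_le_sum fun k hk => ?_
  rw [← hJ.apply i k]
  exact hm k i ((mem_neighbors_comm hJ).1 (hs hk))

theorem PrecisionBound.lt_cavityPrecision (hJ : J.IsSymm) (hv : Dominant J v)
    (hm : PrecisionBound J v m) (hj : j ∈ neighbors J i) :
    |J i j| * v j < cavityPrecision J m i j * v i := by
  have h1 := hm.neg_le_sum hJ (Finset.erase_subset j (neighbors J i))
  have h2 := hv.sum_lt i
  rw [← Finset.sum_erase_add _ _ hj] at h2
  rw [cavityPrecision, add_mul]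
  linarith

theorem PrecisionBound.cavityPrecision_pos (hJ : J.IsSymm) (hv : Dominant J v)
    (hm : PrecisionBound J v m) (hj : j ∈ neighbors J i) : 0 < cavityPrecision J m i j :=
  pos_of_mul_pos_left ((mul_nonneg (abs_nonneg _) (hv.pos j).le).trans_lt
    (hm.lt_cavityPrecision hJ hv hj)) (hv.pos i).le

theorem PrecisionBound.wellPosed (hJ : J.IsSymm) (hv : Dominant J v)
    (hm : PrecisionBound J v m) : WellPosed J m := by
  refine ⟨fun i j hj => hm.cavityPrecision_pos hJ hv hj, fun i => ?_⟩
  have h1 := hm.neg_le_sum hJ (Finset.Subset.refl (neighbors J i))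
  have h2 := hv.sum_lt i
  refine pos_of_mul_pos_left (b := v i) ?_ (hv.pos i).le
  rw [marginalPrecision, add_mul]
  linarith

theorem PrecisionBound.step (hJ : J.IsSymm) (hv : Dominant J v) (hm : PrecisionBound J v m)
    (S : Set (V × V)) : PrecisionBound J v (step J h S m) := by
  intro i j hj
  by_cases hS : (i, j) ∈ S
  · rw [step_α_of_mem hj hS]
    have hκ := hm.cavityPrecision_pos hJ hv hj
    have h1 : J i j ^ 2 * v j ≤ |J i j| * v i * cavityPrecision J m i j := by
      calc J i j ^ 2 * v j = |J i j| * (|J i j| * v j) := by rw [← sq_abs]; ring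
        _ ≤ |J i j| * (cavityPrecision J m i j * v i) :=
          mul_le_mul_of_nonneg_left (hm.lt_cavityPrecision hJ hv hj).le (abs_nonneg _)
        _ = _ := by ring
    have h2 := (div_le_iff₀ hκ).2 h1
    rw [div_eq_mul_inv] at h2
    linarith
  · rw [step_α_of_notMem fun H => hS H.2]
    exact hm i j hj

theorem IsSupersolution.step_le (hm : IsSupersolution J m) (S : Set (V × V)) (i j : V) :
    (step J h S m).α i j ≤ m.α i j := by
  by_cases H : j ∈ neighbors J i ∧ (i, j) ∈ S
  · rw [step_α_of_mem H.1 H.2]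
    exact hm i j H.1
  · exact (step_α_of_notMem H).le

/-- Larger incoming precision messages give a larger outgoing one, so an update of some of the
messages of a supersolution gives a supersolution again. -/
theorem IsSupersolution.step (hJ : J.IsSymm) (hv : Dominant J v) (hb : PrecisionBound J v m)
    (hm : IsSupersolution J m) (S : Set (V × V)) : IsSupersolution J (step J h S m) := by
  intro i j hj
  have hκ := (hb.step (h := h) hJ hv S).cavityPrecision_pos hJ hv hj
  have hle : cavityPrecision J (GaBP.step J h S m) i j ≤ cavityPrecision J m i j := by
    unfold cavityPrecision
    gcongr
    exact hm.step_le S _ _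
  have hF : -(J i j) ^ 2 * (cavityPrecision J (GaBP.step J h S m) i j)⁻¹ ≤
      -(J i j) ^ 2 * (cavityPrecision J m i j)⁻¹ :=
    mul_le_mul_of_nonpos_left (inv_anti₀ hκ hle) (by nlinarith [sq_nonneg (J i j)])
  by_cases hS : (i, j) ∈ S
  · rwa [step_α_of_mem hj hS]
  · rw [step_α_of_notMem fun H => hS H.2]
    exact hF.trans (hm i j hj)

variable {S : ℕ → Set (V × V)}

theorem precisionBound_messages (hJ : J.IsSymm) (hv : Dominant J v) (t : ℕ) :
    PrecisionBound J v (messages J h S t) := by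
  induction t with
  | zero =>
    intro i j _
    have := mul_nonneg (abs_nonneg (J i j)) (hv.pos i).le
    simpa [messages] using this
  | succ t ih => exact ih.step hJ hv _

theorem isSupersolution_messages (hJ : J.IsSymm) (hv : Dominant J v) (t : ℕ) :
    IsSupersolution J (messages J h S t) := by
  induction t with
  | zero =>
    intro i j hj
    have hκ := (precisionBound_messages (h := h) (S := S) hJ hv 0).cavityPrecision_pos hJ hv hj
    simpa [messages] using mul_nonneg (sq_nonneg (J i j)) (inv_nonneg.2 hκ.le)
  | succ t ih => exact ih.step hJ hv (precisionBound_messages hJ hv t) _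

theorem antitone_messages_α (hJ : J.IsSymm) (hv : Dominant J v) (i j : V) :
    Antitone fun t => (messages J h S t).α i j :=
  antitone_nat_of_succ_le fun t => (isSupersolution_messages hJ hv t).step_le _ i j

theorem tendsto_cavityPrecision {ι : Type*} {l : Filter ι} {μ : ι → Messages V}
    (hα : ∀ i j, Tendsto (fun t => (μ t).α i j) l (𝓝 (m.α i j))) (i j : V) :
    Tendsto (fun t => cavityPrecision J (μ t) i j) l (𝓝 (cavityPrecision J m i j)) :=
  (tendsto_finsetSum _ fun k _ => hα k i).const_add _

/-- The precision messages decrease to a fixed point of the precision update, at which the bound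
that keeps the precisions positive is still in force. -/
theorem exists_tendsto_α (hJ : J.IsSymm) (hv : Dominant J v) (hS : FairSchedule J S) :
    ∃ A : V → V → ℝ,
      (∀ i j, Tendsto (fun t => (messages J h S t).α i j) atTop (𝓝 (A i j))) ∧
      (∀ t i j, A i j ≤ (messages J h S t).α i j) ∧
      (∀ B, PrecisionBound J v ⟨A, B⟩) ∧
      ∀ B i, ∀ j ∈ neighbors J i,
        A i j = -(J i j) ^ 2 * (cavityPrecision J ⟨A, B⟩ i j)⁻¹ := by
  have hbdd : ∀ i j, BddBelow (Set.range fun t => (messages J h S t).α i j) := by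
    intro i j
    by_cases hj : j ∈ neighbors J i
    · refine ⟨-(|J i j| * v i) / v j, ?_⟩
      rintro _ ⟨t, rfl⟩
      exact (div_le_iff₀ (hv.pos j)).2 (precisionBound_messages hJ hv t i j hj)
    · refine ⟨0, ?_⟩
      rintro _ ⟨t, rfl⟩
      exact (messages_of_notMem_neighbors hj t).1.ge
  have hlim := fun i j => tendsto_atTop_ciInf (antitone_messages_α (h := h) (S := S) hJ hv i j)
    (hbdd i j)
  have hbound : ∀ B, PrecisionBound J v ⟨fun i j => ⨅ t, (messages J h S t).α i j, B⟩ :=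
    fun B i j hj => ge_of_tendsto ((hlim i j).mul_const (v j))
      (Eventually.of_forall fun t => precisionBound_messages hJ hv t i j hj)
  refine ⟨fun i j => ⨅ t, (messages J h S t).α i j, hlim, fun t i j => ciInf_le (hbdd i j) t,
    hbound, fun B i j hj => ?_⟩
  have hF := ((tendsto_cavityPrecision (J := J) (μ := messages J h S) (m := ⟨_, B⟩) hlim i j).inv₀
    ((hbound B).cavityPrecision_pos hJ hv hj).ne').const_mul (-(J i j) ^ 2)
  -- Along the rounds that update the edge `(i, j)`, the next message equals the update map.
  exact tendsto_nhds_unique_of_frequently_eq ((tendsto_add_atTop_iff_nat 1).2 (hlim i j)) hF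
    ((hS i j hj).mono fun t ht => step_α_of_mem hj ht)

/-! ### The potential messages -/

/-- If `J x = h`, the potential messages `-J_{ij} x_i + α_{ij} x_j` satisfy the update equation for
arbitrary precision messages: both sides express the elimination of `x_i` from its equation. -/
theorem update_exact (hJ : J.IsSymm) {x : V → ℝ} {A B : V → V → ℝ}
    (hx : J.mulVec x i = h i) (hB : ∀ k, B k i = -J k i * x k + A k i * x i)
    (hj : j ∈ neighbors J i) (hκ : cavityPrecision J ⟨A, B⟩ i j ≠ 0) :
    -(J i j) * (cavityPrecision J ⟨A, B⟩ i j)⁻¹ * cavityPotential J h ⟨A, B⟩ i j =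
      -J i j * x i + -(J i j) ^ 2 * (cavityPrecision J ⟨A, B⟩ i j)⁻¹ * x j := by
  have hpot : cavityPotential J h ⟨A, B⟩ i j =
      cavityPrecision J ⟨A, B⟩ i j * x i + J i j * x j := by
    have h1 := mulVec_eq_sum_neighbors J x i
    rw [hx, ← Finset.sum_erase_add _ _ hj] at h1
    simp only [cavityPotential, cavityPrecision, h1, hB, Finset.sum_add_distrib, add_mul,
      Finset.sum_mul, neg_mul, Finset.sum_neg_distrib, hJ.apply i]
    ring
  rw [hpot]
  field_simp
  ring

theorem meanEstimate_exact (hJ : J.IsSymm) {x : V → ℝ} {A B : V → V → ℝ}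
    (hx : J.mulVec x i = h i) (hB : ∀ k, B k i = -J k i * x k + A k i * x i)
    (hκ : marginalPrecision J ⟨A, B⟩ i ≠ 0) :
    meanEstimate J h ⟨A, B⟩ i = x i := by
  have hpot : h i + ∑ k ∈ neighbors J i, B k i = marginalPrecision J ⟨A, B⟩ i * x i := by
    rw [← hx, mulVec_eq_sum_neighbors]
    simp only [marginalPrecision, hB, Finset.sum_add_distrib, add_mul,
      Finset.sum_mul, neg_mul, Finset.sum_neg_distrib, hJ.apply i]
    ring
  rw [meanEstimate, varianceEstimate]
  simp only [hpot]
  exact inv_mul_cancel_left₀ hκ _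

/-- The weights `|J_{ij}| v_i + α_{ij} v_j`, for a fixed point `α` of the precision updates, are
positive and strictly decreased by the homogeneous potential update with absolute values. They are
the potential messages of the model with off-diagonal entries `-|J_{ij}|` and solution `v`, whose
potential vector is positive. -/
theorem weight_contraction (hJ : J.IsSymm) (hv : Dominant J v) {A B : V → V → ℝ}
    (hb : PrecisionBound J v ⟨A, B⟩)
    (hfix : ∀ i, ∀ j ∈ neighbors J i,
      A i j = -(J i j) ^ 2 * (cavityPrecision J ⟨A, B⟩ i j)⁻¹)
    (hj : j ∈ neighbors J i) :
    |J i j| * (cavityPrecision J ⟨A, B⟩ i j)⁻¹ *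
      ∑ k ∈ (neighbors J i).erase j, (|J k i| * v k + A k i * v i) <
      |J i j| * v i + A i j * v j := by
  have hκ := hb.cavityPrecision_pos hJ hv hj
  have hJ0 : 0 < |J i j| := abs_pos.2 (mem_neighbors.1 hj).2
  have hsum : ∑ k ∈ (neighbors J i).erase j, (|J k i| * v k + A k i * v i) <
      cavityPrecision J ⟨A, B⟩ i j * v i - |J i j| * v j := by
    have h2 := hv.sum_lt i
    rw [← Finset.sum_erase_add _ _ hj] at h2
    simp only [cavityPrecision, Finset.sum_add_distrib, add_mul, Finset.sum_mul, hJ.apply i]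
    linarith
  calc _ < |J i j| * (cavityPrecision J ⟨A, B⟩ i j)⁻¹ *
        (cavityPrecision J ⟨A, B⟩ i j * v i - |J i j| * v j) := by gcongr
    _ = |J i j| * v i + -(|J i j|) ^ 2 * (cavityPrecision J ⟨A, B⟩ i j)⁻¹ * v j := by
      field_simp
      ring
    _ = _ := by rw [sq_abs, ← hfix i j hj]

/-- The potential messages converge. Their deviation from the exact messages
`-J_{ij} x_i + α_{ij} x_j` obeys the homogeneous update; as the precision messages decrease, its
coefficients are bounded by those at the limit of the precisions, where the update contracts. -/
theorem tendsto_β (hJ : J.IsSymm) (hv : Dominant J v) (hS : FairSchedule J S) {x : V → ℝ}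
    (hx : J.mulVec x = h) {A B : V → V → ℝ}
    (hlim : ∀ i j, Tendsto (fun t => (messages J h S t).α i j) atTop (𝓝 (A i j)))
    (hle : ∀ t i j, A i j ≤ (messages J h S t).α i j)
    (hb : PrecisionBound J v ⟨A, B⟩)
    (hfix : ∀ i, ∀ j ∈ neighbors J i,
      A i j = -(J i j) ^ 2 * (cavityPrecision J ⟨A, B⟩ i j)⁻¹)
    (hj : j ∈ neighbors J i) :
    Tendsto (fun t => (messages J h S t).β i j) atTop (𝓝 (-J i j * x i + A i j * x j)) := by
  let e : ℕ → V → V → ℝ := fun t i j =>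
    (messages J h S t).β i j - (-J i j * x i + (messages J h S t).α i j * x j)
  let w : V → V → ℝ := fun i j => |J i j| * v i + A i j * v j
  have hw0 : ∀ i, ∀ j ∈ neighbors J i, 0 ≤ w i j := fun i j hj => by
    have := hb i j hj
    simp only [w]
    linarith
  have hwlt := fun i j (hj : j ∈ neighbors J i) => weight_contraction hJ hv hb hfix hj
  have hsum0 : ∀ i j, 0 ≤ ∑ k ∈ (neighbors J i).erase j, w k i := fun i j =>
    Finset.sum_nonneg fun k hk =>
      hw0 k i ((mem_neighbors_comm hJ).1 (Finset.mem_of_mem_erase hk))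
  have hupd : ∀ t i, ∀ j ∈ neighbors J i, (i, j) ∈ S t → e (t + 1) i j =
      -J i j * (cavityPrecision J (messages J h S t) i j)⁻¹ *
        ∑ k ∈ (neighbors J i).erase j, e t k i := by
    intro t i j hj ht
    have hex := update_exact (A := (messages J h S t).α)
      (B := fun k l => -J k l * x k + (messages J h S t).α k l * x l) hJ (congrFun hx i)
      (fun k => rfl) hj ((precisionBound_messages hJ hv t).cavityPrecision_pos hJ hv hj).ne'
    have hα : (messages J h S (t + 1)).α i j =
      -(J i j) ^ 2 * (cavityPrecision J (messages J h S t) i j)⁻¹ := step_α_of_mem hj ht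
    have hβ : (messages J h S (t + 1)).β i j = -(J i j) *
      (cavityPrecision J (messages J h S t) i j)⁻¹ *
        cavityPotential J h (messages J h S t) i j := step_β_of_mem hj ht
    simp only [e, hα, hβ]
    refine (congrArg (_ - ·) hex.symm).trans ?_
    simp only [cavityPotential, cavityPrecision, Finset.sum_sub_distrib]
    ring
  have key := tendsto_zero_of_async_contraction
    (ι := {p : V × V // p.2 ∈ neighbors J p.1}) (e := fun t p => e t p.1.1 p.1.2)
    (w := fun p => w p.1.1 p.1.2) (U := fun t => {p | p.1 ∈ S t})
    (u := fun p => |J p.1.1 p.1.2| * (cavityPrecision J ⟨A, B⟩ p.1.1 p.1.2)⁻¹ *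
      ∑ k ∈ (neighbors J p.1.1).erase p.1.2, w k p.1.1)
    (fun p => (mul_nonneg (mul_nonneg (abs_nonneg _)
      (inv_nonneg.2 (hb.cavityPrecision_pos hJ hv p.2).le)) (hsum0 _ _)).trans_lt
        (hwlt _ _ p.2))
    (fun p => hwlt _ _ p.2) (fun p => hS _ _ p.2)
    (fun t p hp => by
      have hα : (messages J h S (t + 1)).α p.1.1 p.1.2 = (messages J h S t).α p.1.1 p.1.2 :=
        step_α_of_notMem fun H => hp H.2
      have hβ : (messages J h S (t + 1)).β p.1.1 p.1.2 = (messages J h S t).β p.1.1 p.1.2 :=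
        step_β_of_notMem fun H => hp H.2
      simp only [e, hα, hβ])
    (fun t M hM hbox p hp => by
      obtain ⟨⟨i, j⟩, hj⟩ := p
      have hκ := hb.cavityPrecision_pos hJ hv hj
      have hκle : cavityPrecision J ⟨A, B⟩ i j ≤ cavityPrecision J (messages J h S t) i j := by
        unfold cavityPrecision
        gcongr
        exact hle t _ _
      have hsum : |∑ k ∈ (neighbors J i).erase j, e t k i| ≤
          M * ∑ k ∈ (neighbors J i).erase j, w k i := by
        rw [Finset.mul_sum]
        refine (Finset.abs_sum_le_sum_abs _ _).trans (Finset.sum_le_sum fun k hk => ?_)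
        exact hbox ⟨(k, i), (mem_neighbors_comm hJ).1 (Finset.mem_of_mem_erase hk)⟩
      show |e (t + 1) i j| ≤ M * (|J i j| * (cavityPrecision J ⟨A, B⟩ i j)⁻¹ *
        ∑ k ∈ (neighbors J i).erase j, w k i)
      rw [hupd t i j hj hp, abs_mul, abs_mul, abs_neg, abs_inv, abs_of_pos (hκ.trans_le hκle)]
      calc _ ≤ |J i j| * (cavityPrecision J ⟨A, B⟩ i j)⁻¹ *
            (M * ∑ k ∈ (neighbors J i).erase j, w k i) := by gcongr
        _ = _ := by ring)
    ⟨(i, j), hj⟩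
  have := key.add (((hlim i j).mul_const (x j)).const_add (-J i j * x i))
  simpa [e] using this

/-- Gaussian belief propagation in a generalized diagonally dominant model converges, and its means
are exact. -/
theorem Dominant.converges (hJ : J.IsSymm) (hv : Dominant J v) (hS : FairSchedule J S)
    {x : V → ℝ} (hx : J.mulVec x = h) :
    Converges J h S ∧
      ∀ i, Tendsto (fun t => meanEstimate J h (messages J h S t) i) atTop (𝓝 (x i)) := by
  obtain ⟨A, hα, hle, hb, hfix⟩ := exists_tendsto_α (h := h) hJ hv hS
  have hA0 : ∀ i j, j ∉ neighbors J i → A i j = 0 := fun i j hj =>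
    tendsto_nhds_unique (hα i j)
      (tendsto_const_nhds.congr fun t => (messages_of_notMem_neighbors hj t).1.symm)
  let m : Messages V :=
    ⟨A, fun i j => if j ∈ neighbors J i then -J i j * x i + A i j * x j else 0⟩
  have hm : WellPosed J m := (hb _).wellPosed hJ hv
  have hβ : ∀ i j, Tendsto (fun t => (messages J h S t).β i j) atTop (𝓝 (m.β i j)) := by
    intro i j
    by_cases hj : j ∈ neighbors J i
    · simpa [m, hj] using tendsto_β hJ hv hS hx hα hle (hb 0) (hfix 0) hj
    · simp [messages_of_notMem_neighbors hj, m, hj]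
  have hvar : ∀ i, Tendsto (fun t => varianceEstimate J (messages J h S t) i) atTop
      (𝓝 (varianceEstimate J m i)) := fun i =>
    ((tendsto_finsetSum (neighbors J i) fun k _ => hα k i).const_add (J i i)).inv₀ (hm.2 i).ne'
  have hmean : ∀ i, Tendsto (fun t => meanEstimate J h (messages J h S t) i) atTop
      (𝓝 (meanEstimate J h m i)) := fun i =>
    (hvar i).mul ((tendsto_finsetSum (neighbors J i) fun k _ => hβ k i).const_add (h i))
  refine ⟨⟨fun t => (precisionBound_messages hJ hv t).wellPosed hJ hv, m, hm, hα, hβ, hvar,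
    hmean⟩, fun i => ?_⟩
  have hval : meanEstimate J h m i = x i := by
    have := meanEstimate_exact (h := h) (A := A) (B := fun k l => -J k l * x k + A k l * x l) hJ
      (congrFun hx i) (fun k => rfl) (hm.2 i).ne'
    rw [← this, meanEstimate, meanEstimate]
    refine congrArg (fun s => _ * (h i + s)) (Finset.sum_congr rfl fun k hk => ?_)
    simp [m, (mem_neighbors_comm hJ).1 hk]
  exact hval ▸ hmean i

end BeliefPropagation

/-! ### Spectral radius and positive definiteness -/

theorem specRadius_nonneg (A : Matrix V V ℝ) : 0 ≤ specRadius A :=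
  ENNReal.toReal_nonneg

theorem norm_le_specRadius {A : Matrix V V ℝ} {z : ℂ}
    (hz : z ∈ spectrum ℂ (A.map (algebraMap ℝ ℂ))) : ‖z‖ ≤ specRadius A := by
  have h : (‖z‖₊ : ENNReal) ≤ spectralRadius ℂ (A.map (algebraMap ℝ ℂ)) :=
    le_iSup₂ (f := fun (k : ℂ) (_ : k ∈ spectrum ℂ (A.map (algebraMap ℝ ℂ))) =>
      (‖k‖₊ : ENNReal)) z hz
  simpa [specRadius] using ENNReal.toReal_mono (spectralRadius_ne_top A) h

theorem abs_le_specRadius {A : Matrix V V ℝ} {r : ℝ} (hr : r ∈ spectrum ℝ A) :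
    |r| ≤ specRadius A := by
  have hz : (r : ℂ) ∈ spectrum ℂ (A.map (algebraMap ℝ ℂ)) := by
    rw [Matrix.mem_spectrum_iff_isRoot_charpoly] at hr ⊢
    rw [Matrix.charpoly_map]
    exact hr.map
  simpa using norm_le_specRadius hz

theorem specRadius_smul_lt_one {A : Matrix V V ℝ} {c : ℝ} (hc : specRadius A < c) :
    specRadius (c⁻¹ • A) < 1 := by
  have hc0 : 0 < c := (specRadius_nonneg A).trans_lt hc
  have hle : spectralRadius ℂ ((c⁻¹ • A).map (algebraMap ℝ ℂ)) ≤
      ENNReal.ofReal (specRadius A / c) := by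
    refine iSup₂_le fun z hz => ?_
    have hu : (Units.mk0 (c : ℂ) (by exact_mod_cast hc0.ne')) •
        (c⁻¹ • A).map (algebraMap ℝ ℂ) = A.map (algebraMap ℝ ℂ) := by
      ext i j
      have : (c : ℂ) ≠ 0 := by exact_mod_cast hc0.ne'
      simp [Units.smul_def, this]
    have hmem := norm_le_specRadius (A := A) (z := (c : ℂ) * z) (by
      rw [← hu]
      exact spectrum.smul_mem_smul_iff.2 hz)
    rw [norm_mul, Complex.norm_real, Real.norm_of_nonneg hc0.le] at hmem
    rw [← enorm_eq_nnnorm, ← ofReal_norm]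
    exact ENNReal.ofReal_le_ofReal ((le_div_iff₀' hc0).2 hmem)
  refine (ENNReal.toReal_mono ENNReal.ofReal_ne_top hle).trans_lt ?_
  rw [ENNReal.toReal_ofReal (div_nonneg (specRadius_nonneg A) hc0.le)]
  exact (div_lt_one hc0).2 hc

/-- The eigenvalues of `c - B` are `c - μ` with `μ` an eigenvalue of `B`, so at least
`c - ρ(B)`. -/
theorem posDef_algebraMap_sub {B : Matrix V V ℝ} (hB : B.IsSymm) {c : ℝ}
    (hc : specRadius B < c) : (algebraMap ℝ (Matrix V V ℝ) c - B).PosDef := by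
  have hH : (algebraMap ℝ (Matrix V V ℝ) c - B).IsHermitian := by
    rw [Matrix.IsHermitian, Matrix.conjTranspose_eq_transpose_of_trivial,
      Matrix.transpose_sub, hB.eq, Matrix.algebraMap_eq_diagonal, Matrix.diagonal_transpose]
  refine hH.posDef_iff_eigenvalues_pos.2 fun i => ?_
  have h := hH.eigenvalues_mem_spectrum_real i
  rw [← spectrum.singleton_sub_eq] at h
  obtain ⟨_, rfl, μ, hμ, hi⟩ := Set.mem_sub.1 h
  have := (le_abs_self μ).trans (abs_le_specRadius hμ)
  linarith

theorem algebraMap_sub_mulVec (c : ℝ) (B : Matrix V V ℝ) (x : V → ℝ) (i : V) :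
    ((algebraMap ℝ (Matrix V V ℝ) c - B).mulVec x) i = c * x i - ∑ j, B i j * x j := by
  simp [Matrix.sub_mulVec, Algebra.algebraMap_eq_smul_one, Matrix.smul_mulVec]
  rfl

/-- A positive definite matrix `c - B` with `B ≥ 0` entrywise is an M-matrix: it maps some positive
vector to the all-ones vector. The negative part `n` of the solution satisfies `nᵀ(c - B)n ≤ 0`. -/
theorem exists_pos_mulVec_eq_one {B : Matrix V V ℝ} (hB : ∀ i j, 0 ≤ B i j) {c : ℝ}
    (hc : 0 < c) (hP : (algebraMap ℝ (Matrix V V ℝ) c - B).PosDef) :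
    ∃ v : V → ℝ, (∀ i, 0 < v i) ∧ ∀ i, c * v i - ∑ j, B i j * v j = 1 := by
  set P := algebraMap ℝ (Matrix V V ℝ) c - B with hPdef
  obtain ⟨v, hv⟩ : ∃ v : V → ℝ, P.mulVec v = fun _ => 1 := by
    refine ⟨P⁻¹.mulVec fun _ => 1, ?_⟩
    rw [Matrix.mulVec_mulVec, Matrix.mul_nonsing_inv _ (isUnit_iff_ne_zero.2 hP.det_pos.ne'),
      Matrix.one_mulVec]
  have hvi : ∀ i, c * v i - ∑ j, B i j * v j = 1 := fun i => by
    rw [← algebraMap_sub_mulVec, ← hPdef, hv]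
  let n : V → ℝ := fun i => (v i)⁻
  have hn : n = 0 := by
    by_contra hne
    have hpos := hP.dotProduct_mulVec_pos hne
    have hle : star n ⬝ᵥ P.mulVec n ≤ 0 := by
      refine Finset.sum_nonpos fun i _ => ?_
      have hneg : P.mulVec n i = -1 + (c * (v i)⁺ - ∑ j, B i j * (v j)⁺) := by
        rw [hPdef, algebraMap_sub_mulVec, ← hvi i]
        have : ∀ j, (v j)⁺ = v j + n j := fun j => by
          have := posPart_sub_negPart (v j)
          simp only [n]
          linarith
        simp only [this, mul_add, Finset.sum_add_distrib]
        ring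
      have h0 : n i * (v i)⁺ = 0 := by
        rcases le_total 0 (v i) with hi | hi
        · simp [n, negPart_eq_zero.2 hi]
        · simp [posPart_eq_zero.2 hi]
      have h1 : 0 ≤ n i := negPart_nonneg _
      have h2 : 0 ≤ ∑ j, B i j * (v j)⁺ :=
        Finset.sum_nonneg fun j _ => mul_nonneg (hB i j) (posPart_nonneg _)
      have h3 := mul_nonneg h1 h2
      show n i * P.mulVec n i ≤ 0
      rw [hneg]
      linear_combination h1 + h3 + c * h0
    exact hpos.not_ge hle
  have hv0 : ∀ i, 0 ≤ v i := fun i => negPart_eq_zero.1 (congrFun hn i)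
  refine ⟨v, fun i => ?_, hvi⟩
  have h2 : 0 ≤ ∑ j, B i j * v j := Finset.sum_nonneg fun j _ => mul_nonneg (hB i j) (hv0 j)
  have := hvi i
  exact pos_of_mul_pos_right (a := c) (by linarith) hc.le

/-- Passing from `x` to `|x|` and from `R` to `|R|` does not increase the quadratic form of
`c - R`. -/
theorem posDef_algebraMap_sub_of_absMatrix {R : Matrix V V ℝ} (hR : R.IsSymm) {c : ℝ}
    (hP : (algebraMap ℝ (Matrix V V ℝ) c - absMatrix R).PosDef) :
    (algebraMap ℝ (Matrix V V ℝ) c - R).PosDef := by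
  refine Matrix.PosDef.of_dotProduct_mulVec_pos ?_ fun x hx => ?_
  · rw [Matrix.IsHermitian, Matrix.conjTranspose_eq_transpose_of_trivial,
      Matrix.transpose_sub, hR.eq, Matrix.algebraMap_eq_diagonal, Matrix.diagonal_transpose]
  · refine (hP.dotProduct_mulVec_pos (x := fun i => |x i|) fun h =>
      hx (funext fun i => abs_eq_zero.1 (congrFun h i))).trans_le
        (Finset.sum_le_sum fun i _ => ?_)
    simp only [algebraMap_sub_mulVec, Pi.star_apply, star_trivial, mul_sub]
    have h1 : |x i| * (c * |x i|) = x i * (c * x i) := by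
      linear_combination c * abs_mul_abs_self (x i)
    have h2 : x i * ∑ j, R i j * x j ≤ |x i| * ∑ j, absMatrix R i j * |x j| := by
      refine (le_abs_self _).trans ?_
      rw [abs_mul]
      refine mul_le_mul_of_nonneg_left ((Finset.abs_sum_le_sum_abs _ _).trans_eq ?_) (abs_nonneg _)
      simp [absMatrix, abs_mul]
    linarith

end GaBP

theorem lemma1 {V : Type*} [Fintype V] [DecidableEq V] (R J' : Matrix V V ℝ)
    (hsymm : R.IsSymm) (hdiag : ∀ i, R i i = 0) (γ : ℝ)
    (hγ : GaBP.specRadius (GaBP.absMatrix R) - 1 < γ)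
    (hJ' : J' = (1 - R) + γ • (1 : Matrix V V ℝ)) :
    -- normalization of `J'` to unit diagonal, and walk-summability
    0 < 1 + γ ∧
    GaBP.normalize J' = 1 - (1 + γ)⁻¹ • R ∧
    GaBP.specRadius ((1 + γ)⁻¹ • GaBP.absMatrix R) < 1 ∧
    GaBP.WalkSummable J' ∧
    -- `J'` is a valid information matrix, and belief propagation converges to the MAP estimate
    J'.PosDef ∧
    ∀ (h : V → ℝ) (S : ℕ → Set (V × V)), GaBP.FairSchedule J' S →
      GaBP.Converges J' h S ∧
      ∀ i, Tendsto (fun t => GaBP.meanEstimate J' h (GaBP.messages J' h S t) i) atTop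
        (𝓝 ((J'⁻¹).mulVec h i)) := by
  have hρ : GaBP.specRadius (GaBP.absMatrix R) < 1 + γ := by linarith
  have hc : 0 < 1 + γ := (GaBP.specRadius_nonneg _).trans_lt hρ
  have hJ : J' = algebraMap ℝ (Matrix V V ℝ) (1 + γ) - R := by
    rw [hJ', Algebra.algebraMap_eq_smul_one, add_smul, one_smul]
    abel
  have hii : ∀ i, J' i i = 1 + γ := fun i => by simp [hJ', hdiag]
  have hik : ∀ i k, k ≠ i → J' i k = -R i k := fun i k hk => by simp [hJ', hk.symm]
  have hnorm : GaBP.normalize J' = 1 - (1 + γ)⁻¹ • R := by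
    ext i k
    rw [GaBP.normalize, Matrix.of_apply, hii, hii, Real.mul_self_sqrt hc.le]
    by_cases hk : k = i
    · subst hk
      simp [hii, hdiag, hc.ne']
    · simp [hik i k hk, Matrix.one_apply_ne (Ne.symm hk), div_eq_inv_mul]
  have hlt := GaBP.specRadius_smul_lt_one hρ
  have habs : (GaBP.absMatrix R).IsSymm := hsymm.map _
  have hP := GaBP.posDef_algebraMap_sub habs hρ
  have hpd : J'.PosDef := hJ ▸ GaBP.posDef_algebraMap_sub_of_absMatrix hsymm hP
  have hJs : J'.IsSymm := by
    rw [hJ', Matrix.IsSymm, Matrix.transpose_add, Matrix.transpose_sub, hsymm.eq,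
      Matrix.transpose_smul, Matrix.transpose_one]
  obtain ⟨v, hv0, hv⟩ := GaBP.exists_pos_mulVec_eq_one
    (B := GaBP.absMatrix R) (fun i k => abs_nonneg (R i k)) hc hP
  have hdom : GaBP.Dominant J' v := by
    refine ⟨hv0, fun i => ?_⟩
    have h1 : ∑ k ∈ GaBP.neighbors J' i, |J' i k| * v k ≤
        ∑ k, GaBP.absMatrix R i k * v k := by
      refine (Finset.sum_congr rfl fun k hk => ?_).trans_le
        (Finset.sum_le_univ_sum_of_nonneg fun k => mul_nonneg (abs_nonneg (R i k)) (hv0 k).le)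
      rw [hik i k (GaBP.mem_neighbors.1 hk).1, abs_neg]
      rfl
    rw [hii]
    linarith [hv i]
  refine ⟨hc, hnorm, hlt, ⟨fun i => (hii i).symm ▸ hc, ?_⟩, hpd, fun h S hS => ?_⟩
  · have : GaBP.absMatrix (1 - GaBP.normalize J') = (1 + γ)⁻¹ • GaBP.absMatrix R := by
      ext i k
      simp [hnorm, GaBP.absMatrix, abs_mul, abs_of_pos hc]
    rwa [this]
  · refine hdom.converges hJs hS ?_
    rw [Matrix.mulVec_mulVec, Matrix.mul_nonsing_inv _ (isUnit_iff_ne_zero.2 hpd.det_pos.ne'),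
      Matrix.one_mulVec]
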